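/- Let $M$ be a smooth manifold, $A\to M$ a smooth real vector bundle of finite rank, $A^*$ its dual, and let $((A,\mu),(A^*,\gamma))$ be a Lie bialgebroid: $\mu$ and $\gamma$ are Lie algebroid structures on $A$ and $A^*$, with brackets $[\,,]^\mu$, $[\,,]^\gamma$, differentials $\mathrm d_\mu$, $\mathrm d_\gamma$ and Lie derivatives $\mathcal L^\mu$, $\mathcal L^\gamma$, such that $\mathrm d_\gamma$ is a derivation of the Schouten bracket of $\mu$ on $\Gamma(\wedge^\bullet A)$ (equivalently $\{\mu,\gamma\}=0$ for the big bracket). Its double is the Courant algebroid $(A\oplus A^*,\mu+\gamma)$, with the symmetric form $\langle X+\xi,Y+\eta\rangle=\langle\xi,Y\rangle+\langle\eta,X\rangle$ and the Dorfman bracket $$[X+\xi,Y+\eta]=[X,Y]^\mu+\mathcal L^\gamma_\xi Y-i_\eta\mathrm d_\gamma X+[\xi,\eta]^\gamma+\mathcal L^\mu_X\eta-i_Y\mathrm d_\mu\xi$$ for $X,Y\in\Gamma(A)$ and $\xi,\eta\in\Gamma(A^*)$. For a bracket $[\,,]$ on sections and a vector bundle endomorphism $K$, the torsion of $K$ is $(TK)(u,v)=[Ku,Kv]-K\big([Ku,v]+[u,Kv]-K[u,v]\big)$;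 write $T_\mu$, $T_\gamma$, $T_{\mu+\gamma}$ for the three brackets above. An almost cps structure on $A$ is an endomorphism $J$ of $A$ with $J^2=\varepsilon\,\mathrm{Id}_A$, $\varepsilon\in\{-1,1,0\}$. **Theorem.** Let $N=cJ$ with $c\in\mathbb R$ and $J$ an almost cps structure on $A$. If $T_\mu N=0$ and $T_\gamma({}^tN)=0$, then $$\mathcal N=\begin{pmatrix}N&0\\0&-{}^tN\end{pmatrix}$$ is a Nijenhuis tensor for the Courant algebroid $(A\oplus A^*,\mu+\gamma)$: it is skew-symmetric, $\langle\mathcal Nu,v\rangle+\langle u,\mathcal Nv\rangle=0$, and $(T_{\mu+\gamma}\mathcal N)(u,v)=0$ for all sections $u,v$ of $A\oplus A^*$. -/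

import Mathlib

open Bundle Topology Module
open scoped Manifold ContDiff

noncomputable section
set_option linter.unusedSectionVars false

namespace LieBialg

variable {E : Type*} [NormedAddCommGroup E] [NormedSpace ℝ E]
  {H : Type*} [TopologicalSpace H] {I : ModelWithCorners ℝ E H}
  {M : Type*} [TopologicalSpace M] [ChartedSpace H M]
  {F : Type*} [NormedAddCommGroup F] [NormedSpace ℝ F]
  {V : M → Type*} [TopologicalSpace (TotalSpace F V)] [∀ x, TopologicalSpace (V x)]
  [∀ x, AddCommGroup (V x)] [∀ x, Module ℝ (V x)] [FiberBundle F V] [VectorBundle ℝ F V]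
  {G : Type*} [NormedAddCommGroup G] [NormedSpace ℝ G]
  {W : M → Type*} [TopologicalSpace (TotalSpace G W)] [∀ x, TopologicalSpace (W x)]
  [∀ x, AddCommGroup (W x)] [∀ x, Module ℝ (W x)] [FiberBundle G W] [VectorBundle ℝ G W]

/-- The algebra `C^∞(M)` of smooth real-valued functions on `M`. -/
abbrev Fun (I : ModelWithCorners ℝ E H) (M : Type*) [TopologicalSpace M] [ChartedSpace H M] :=
  C^∞⟮I, M; 𝓘(ℝ), ℝ⟯

/-- The space `Γ(V)` of smooth sections of the vector bundle `V` (with typical fibre `F`). -/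
abbrev Sec (I : ModelWithCorners ℝ E H) (F : Type*) [NormedAddCommGroup F] [NormedSpace ℝ F]
    (V : M → Type*) [TopologicalSpace (TotalSpace F V)] [∀ x, TopologicalSpace (V x)]
    [FiberBundle F V] :=
  Cₛ^∞⟮I; F, V⟯

/-! ### Sections as a module over the smooth functions -/

/-- Pointwise multiplication of a section by a smooth function. -/
instance sectionSMul : SMul (Fun I M) (Sec I F V) :=
  ⟨fun f s => ⟨fun x => f x • s x, f.contMDiff.smul_section s.contMDiff⟩⟩

@[simp] theorem section_smul_apply (f : Fun I M) (s : Sec I F V) (x : M) :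
    (f • s) x = f x • s x := rfl

instance sectionModule : Module (Fun I M) (Sec I F V) where
  one_smul s := by ext x; exact one_smul ℝ (s x)
  mul_smul f g s := by ext x; exact mul_smul (f x) (g x) (s x)
  smul_zero f := by ext x; exact smul_zero (f x)
  smul_add f s t := by ext x; exact smul_add (f x) (s x) (t x)
  add_smul f g s := by ext x; exact add_smul (f x) (g x) (s x)
  zero_smul s := by ext x; exact zero_smul ℝ (s x)

/-- Vector bundle morphisms `V → W` over the identity of `M`: smooth sections of `Hom(V, W)`. -/
abbrev BundleHom (I : ModelWithCorners ℝ E H) (F : Type*) [NormedAddCommGroup F] [NormedSpace ℝ F]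
    (V : M → Type*) [TopologicalSpace (TotalSpace F V)] [∀ x, TopologicalSpace (V x)]
    [∀ x, AddCommGroup (V x)] [∀ x, Module ℝ (V x)] [FiberBundle F V] [VectorBundle ℝ F V]
    (G : Type*) [NormedAddCommGroup G] [NormedSpace ℝ G]
    (W : M → Type*) [TopologicalSpace (TotalSpace G W)] [∀ x, TopologicalSpace (W x)]
    [∀ x, AddCommGroup (W x)] [∀ x, Module ℝ (W x)] [FiberBundle G W] [VectorBundle ℝ G W]
    [∀ x, IsTopologicalAddGroup (W x)] [∀ x, ContinuousSMul ℝ (W x)] :=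
  Sec I (F →L[ℝ] G) (fun x => V x →L[ℝ] W x)

/-- The dual bundle `V*`, i.e. the bundle of homomorphisms from `V` to the trivial line bundle. -/
abbrev DualBundle (V : M → Type*) [∀ x, TopologicalSpace (V x)]
    [∀ x, AddCommGroup (V x)] [∀ x, Module ℝ (V x)] : M → Type _ :=
  fun x => V x →L[ℝ] Trivial M ℝ x

/-- The space `Γ(V*)` of smooth sections of the dual bundle. -/
abbrev DualSec (I : ModelWithCorners ℝ E H) (F : Type*) [NormedAddCommGroup F] [NormedSpace ℝ F]
    (V : M → Type*) [TopologicalSpace (TotalSpace F V)] [∀ x, TopologicalSpace (V x)]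
    [∀ x, AddCommGroup (V x)] [∀ x, Module ℝ (V x)] [FiberBundle F V] [VectorBundle ℝ F V] :=
  Sec I (F →L[ℝ] ℝ) (DualBundle V)

/-- The Whitney sum `V ⊕ V*`. -/
abbrev DoubleBundle (V : M → Type*) [∀ x, TopologicalSpace (V x)]
    [∀ x, AddCommGroup (V x)] [∀ x, Module ℝ (V x)] : M → Type _ :=
  fun x => V x × DualBundle V x

/-- The space `Γ(V ⊕ V*)` of smooth sections of the Whitney sum. -/
abbrev DoubleSec (I : ModelWithCorners ℝ E H) (F : Type*) [NormedAddCommGroup F]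
    [NormedSpace ℝ F] (V : M → Type*) [TopologicalSpace (TotalSpace F V)]
    [∀ x, TopologicalSpace (V x)] [∀ x, AddCommGroup (V x)] [∀ x, Module ℝ (V x)]
    [FiberBundle F V] [VectorBundle ℝ F V] :=
  Sec I (F × (F →L[ℝ] ℝ)) (DoubleBundle V)

section
variable [∀ x, IsTopologicalAddGroup (W x)] [∀ x, ContinuousSMul ℝ (W x)]

/-- The `C^∞(M)`-linear map on sections induced by a bundle morphism. -/
def BundleHom.map (φ : BundleHom I F V G W) :
    Sec I F V →ₗ[Fun I M] Sec I G W where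
  toFun s := ⟨fun x => φ x (s x), φ.contMDiff.clm_bundle_apply s.contMDiff⟩
  map_add' s t := by ext x; exact map_add (φ x) (s x) (t x)
  map_smul' f s := by ext x; exact map_smul (φ x) (f x) (s x)

@[simp] theorem BundleHom.map_apply (φ : BundleHom I F V G W) (s : Sec I F V) (x : M) :
    φ.map s x = φ x (s x) := rfl
end

theorem contMDiff_trivial_iff (f : M → ℝ) :
    ContMDiff I (I.prod 𝓘(ℝ)) ∞ (fun x => TotalSpace.mk' ℝ (E := Trivial M ℝ) x (f x)) ↔
      ContMDiff I 𝓘(ℝ) ∞ f := by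
  refine forall_congr' fun x => ?_
  rw [contMDiffAt_section]
  rfl

/-- The duality pairing `⟨ξ, X⟩` of sections of `V*` and of `V`, with values in `C^∞(M)`. -/
def pairing : DualSec I F V →ₗ[Fun I M]
    Sec I F V →ₗ[Fun I M] Fun I M :=
  LinearMap.mk₂ _ (fun ξ X => ⟨fun x => ξ x (X x),
      (contMDiff_trivial_iff _).1 (ξ.contMDiff.clm_bundle_apply X.contMDiff)⟩)
    (fun _ _ _ => by ext x; rfl) (fun _ _ _ => by ext x; rfl)
    (fun ξ X Y => by ext x; exact map_add (ξ x) (X x) (Y x))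
    (fun f ξ X => by ext x; exact map_smul (ξ x) (f x) (X x))

@[simp] theorem pairing_apply (ξ : DualSec I F V) (X : Sec I F V) (x : M) :
    pairing ξ X x = ξ x (X x) := rfl

section
variable [FiniteDimensional ℝ E] [T2Space M] [IsManifold I ∞ M] 

theorem exists_bump (x₀ : M) {U : Set M} (hU : U ∈ 𝓝 x₀) :
    ∃ χ : Fun I M, (∀ᶠ x in 𝓝 x₀, χ x = 1) ∧ tsupport χ ⊆ U := by
  obtain ⟨f, -, hf⟩ := (SmoothBumpFunction.nhds_basis_tsupport (I := I) x₀).mem_iff.1 hU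
  exact ⟨⟨f, f.contMDiff⟩, f.eventuallyEq_one, hf⟩

theorem exists_global_section {s : ∀ x, V x} {U : Set M} (hU : IsOpen U)
    (hs : ContMDiffOn I (I.prod 𝓘(ℝ, F)) ∞ (fun x => TotalSpace.mk' F x (s x)) U)
    {x₀ : M} (hx : x₀ ∈ U) : ∃ σ : Sec I F V, ∀ᶠ x in 𝓝 x₀, σ x = s x := by
  obtain ⟨χ, h1, h2⟩ := exists_bump (I := I) x₀ (hU.mem_nhds hx)
  refine ⟨⟨fun x => χ x • s x,
    ContMDiffOn.smul_section_of_tsupport χ.contMDiff.contMDiffOn hU h2 hs⟩, ?_⟩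
  filter_upwards [h1] with x hx
  simp [hx]

variable [FiniteDimensional ℝ F] [ContMDiffVectorBundle ∞ F V I]

theorem exists_section_eq {x₀ : M} (v : V x₀) : ∃ σ : Sec I F V, σ x₀ = v := by
  obtain ⟨σ, h⟩ := exists_global_section (I := I) (F := F) (V := V)
    (s := FiberBundle.extend F v) (trivializationAt F V x₀).open_baseSet
    (by
      rw [Trivialization.contMDiffOn_section_baseSet_iff]
      refine (contMDiffOn_const (c := (trivializationAt F V x₀ ⟨x₀, v⟩).2)).congr fun y hy => ?_
      simp [FiberBundle.extend, hy])
    (FiberBundle.mem_baseSet_trivializationAt' x₀)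
  exact ⟨σ, by simpa using h.self_of_nhds⟩

variable [ContMDiffVectorBundle ∞ G W I] 
/-- A family of linear maps is smooth if it maps smooth sections to smooth sections. -/
theorem contMDiff_hom_of_apply [∀ x, IsTopologicalAddGroup (W x)] [∀ x, ContinuousSMul ℝ (W x)]
    (φ : ∀ x, V x →L[ℝ] W x)
    (h : ∀ X : Sec I F V,
      ContMDiff I (I.prod 𝓘(ℝ, G)) ∞ (fun x => TotalSpace.mk' G x (φ x (X x)))) :
    ContMDiff I (I.prod 𝓘(ℝ, F →L[ℝ] G)) ∞
      (fun x => TotalSpace.mk' (F →L[ℝ] G) (E := fun x => V x →L[ℝ] W x) x (φ x)) := by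
  intro x₀
  rw [contMDiffAt_hom_bundle]
  refine ⟨contMDiffAt_id, ?_⟩
  let b := Module.finBasis ℝ F
  let e := trivializationAt F V x₀
  let e' := trivializationAt G W x₀
  have hx₀ : x₀ ∈ e.baseSet := FiberBundle.mem_baseSet_trivializationAt' x₀
  have hx₀' : x₀ ∈ e'.baseSet := FiberBundle.mem_baseSet_trivializationAt' x₀
  choose σ hσ using fun i => exists_global_section (I := I) (F := F) (V := V) e.open_baseSet
    (e.contMDiffOn_localFrame_baseSet (I := I) ∞ b i) hx₀
  have key : ∀ i, ContMDiffAt I 𝓘(ℝ, G) ∞ (fun x => (e' ⟨x, φ x (σ i x)⟩).2) x₀ := fun i => by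
    have := (h (σ i)).contMDiffAt (x := x₀)
    rw [contMDiffAt_section] at this
    exact this
  let c : Fin (finrank ℝ F) → (F →L[ℝ] ℝ) := fun i => (b.coord i).toContinuousLinearMap
  have hsum : ContMDiffAt I 𝓘(ℝ, F →L[ℝ] G) ∞
      (fun x => ∑ i, ContinuousLinearMap.smulRightL ℝ F G (c i) ((e' ⟨x, φ x (σ i x)⟩).2)) x₀ :=
    ContMDiffAt.sum fun i _ =>
      ((ContinuousLinearMap.smulRightL ℝ F G (c i)).contMDiff.contMDiffAt).comp x₀ (key i)
  refine hsum.congr_of_eventuallyEq ?_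
  filter_upwards [e.open_baseSet.mem_nhds hx₀, e'.open_baseSet.mem_nhds hx₀',
    Filter.eventually_all.2 hσ] with x hx hx' hs
  apply ContinuousLinearMap.coe_injective
  refine b.ext fun j => ?_
  simp only [ContinuousLinearMap.coe_coe]
  rw [ContinuousLinearMap.inCoordinates_eq hx hx']
  have h1 : e.basisAt b hx j = (e.continuousLinearEquivAt ℝ x hx).symm (b j) := by
    simp [Trivialization.basisAt]
  simp [hs, c, Finsupp.single_apply, e.localFrame_apply_of_mem_baseSet b hx, h1, e, e']


/-! ### Sections of the dual bundle are the `C^∞(M)`-linear forms on sections, and conversely -/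

/-- The value of a `C^∞(M)`-linear functional on sections depends on the value of the section only. -/
theorem functional_tensorial (φ : Sec I F V →ₗ[Fun I M] Fun I M)
    {X Y : Sec I F V} {x₀ : M} (h : X x₀ = Y x₀) : φ X x₀ = φ Y x₀ := by
  suffices H : ∀ Z : Sec I F V, Z x₀ = 0 → φ Z x₀ = 0 by
    have := H (X - Y) (by simp [h])
    rw [map_sub] at this
    exact sub_eq_zero.1 this
  intro Z hZ
  have : ContMDiffVectorBundle 1 F V I := ContMDiffVectorBundle.of_le (n := ∞) (by simp)
  let b := Module.finBasis ℝ F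
  let e := trivializationAt F V x₀
  have hx₀ : x₀ ∈ e.baseSet := FiberBundle.mem_baseSet_trivializationAt' x₀
  obtain ⟨χ, h1, h2⟩ := exists_bump (I := I) x₀ (e.open_baseSet.mem_nhds hx₀)
  let s : Fin (finrank ℝ F) → Sec I F V := fun i => ⟨fun x => χ x • e.localFrame b i x,
    ContMDiffOn.smul_section_of_tsupport χ.contMDiff.contMDiffOn e.open_baseSet h2
      (e.contMDiffOn_localFrame_baseSet (I := I) ∞ b i)⟩
  let c : Fin (finrank ℝ F) → Fun I M := fun i =>
    ⟨fun x => χ x * e.localFrameCoeff I b i x (Z x), by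
      have hc := contMDiffOn_baseSet_localFrameCoeff (e := e) (k := ∞) b
        (Z.contMDiff.contMDiffOn) i
      refine contMDiff_of_contMDiffOn_union_of_isOpen
        (χ.contMDiff.contMDiffOn.mul hc) (t := (tsupport χ)ᶜ) ?_ ?_ e.open_baseSet
        (isClosed_tsupport _).isOpen_compl
      · refine (contMDiffOn_const (c := (0 : ℝ))).congr fun y hy => ?_
        simp [image_eq_zero_of_notMem_tsupport hy]
      · exact Set.compl_subset_iff_union.mp <| Set.compl_subset_compl.mpr h2⟩
  have hsum : (χ * χ) • Z = ∑ i, c i • s i := by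
    ext x
    have : (∑ i, c i • s i) x = ∑ i, c i x • s i x := by
      change ContMDiffSection.coeAddHom I F ∞ V (∑ i, c i • s i) x = _
      rw [map_sum, Finset.sum_apply]
      rfl
    rw [this]
    by_cases hx : x ∈ e.baseSet
    · change (χ x * χ x) • Z x = _
      rw [e.eq_sum_localFrameCoeff_smul (I := I) (b := b) (s := Z) hx, Finset.smul_sum]
      refine Finset.sum_congr rfl fun i _ => ?_
      simp only [c, s]
      change _ = (χ x * e.localFrameCoeff I b i x (Z x)) • (χ x • e.localFrame b i x)
      simp only [smul_smul]
      congr 1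
      ring
    · have : χ x = 0 := image_eq_zero_of_notMem_tsupport fun h => hx (h2 h)
      change (χ x * χ x) • Z x =
        ∑ i, (χ x * e.localFrameCoeff I b i x (Z x)) • (χ x • e.localFrame b i x)
      simp [this]
  have h3 := congrArg (fun f => f x₀) (congrArg φ hsum)
  simp only [map_smul, map_sum] at h3
  have h4 : (∑ i, c i • φ (s i)) x₀ = ∑ i, c i x₀ * φ (s i) x₀ := by
    change ContMDiffMap.coeFnAddMonoidHom (∑ i, c i • φ (s i)) x₀ = _
    rw [map_sum, Finset.sum_apply]
    rfl
  rw [h4] at h3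
  have h5 : ∀ i, c i x₀ = 0 := fun i => by
    change χ x₀ * e.localFrameCoeff I b i x₀ (Z x₀) = 0
    simp [hZ]
  change (χ x₀ * χ x₀) * φ Z x₀ = _ at h3
  simpa [h5, h1.self_of_nhds] using h3

theorem pairing_bijective : Function.Bijective (pairing (I := I) (F := F) (V := V)) := by
  constructor
  · intro ξ η h
    ext x v
    obtain ⟨X, rfl⟩ := exists_section_eq (I := I) (F := F) v
    exact congrArg (fun f : Fun I M => f x) (LinearMap.congr_fun h X)
  · intro φ
    have hT2 (x : M) : T2Space (V x) := FiberBundle.t2Space F V x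
    have hfd (x : M) : FiniteDimensional ℝ (V x) := VectorBundle.finiteDimensional ℝ F V x
    have htg (x : M) : IsTopologicalAddGroup (V x) :=
      (VectorBundle.continuousLinearEquivAt ℝ F V x).toContinuousAddEquiv.isTopologicalAddGroup
    have hcs (x : M) : ContinuousSMul ℝ (V x) :=
      (VectorBundle.continuousLinearEquivAt ℝ F V x).continuousSMul
    choose ext hext using fun (x : M) (v : V x) => exists_section_eq (I := I) (F := F) v
    let ξ : ∀ x, V x →L[ℝ] Trivial M ℝ x := fun x => LinearMap.toContinuousLinearMap
      { toFun := fun v => φ (ext x v) x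
        map_add' := fun v w => by
          have := functional_tensorial φ (x₀ := x) (X := ext x (v + w)) (Y := ext x v + ext x w)
            (by simp [hext])
          rw [this, map_add]; rfl
        map_smul' := fun r v => by
          have := functional_tensorial φ (x₀ := x) (X := ext x (r • v))
            (Y := (ContMDiffMap.const r : Fun I M) • ext x v)
            (by simp [hext]; rfl)
          rw [this, map_smul]; rfl }
    have hξ : ∀ (X : Sec I F V) x, ξ x (X x) = φ X x := fun X x =>
      functional_tensorial φ (hext x (X x))
    refine ⟨⟨ξ, contMDiff_hom_of_apply ξ fun X => (contMDiff_trivial_iff _).2 ?_⟩, ?_⟩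
    · simp only [hξ]
      exact (φ X).contMDiff
    · ext X x
      exact hξ X x

theorem pairing_flip_bijective :
    Function.Bijective (pairing (I := I) (F := F) (V := V)).flip := by
  have hT2 (x : M) : T2Space (V x) := FiberBundle.t2Space F V x
  have hfd (x : M) : FiniteDimensional ℝ (V x) := VectorBundle.finiteDimensional ℝ F V x
  have htg (x : M) : IsTopologicalAddGroup (V x) :=
    (VectorBundle.continuousLinearEquivAt ℝ F V x).toContinuousAddEquiv.isTopologicalAddGroup
  have hcs (x : M) : ContinuousSMul ℝ (V x) :=
    (VectorBundle.continuousLinearEquivAt ℝ F V x).continuousSMul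
  constructor
  · intro X Y h
    ext x
    rw [← sub_eq_zero, ← Module.forall_dual_apply_eq_zero_iff ℝ]
    intro f
    obtain ⟨ξ, hξ⟩ := exists_section_eq (I := I) (F := F →L[ℝ] ℝ) (V := DualBundle V) (x₀ := x)
      (LinearMap.toContinuousLinearMap f)
    have := congrArg (fun f : Fun I M => f x) (LinearMap.congr_fun h ξ)
    simp only [LinearMap.flip_apply, pairing_apply, hξ] at this
    rw [map_sub, sub_eq_zero]
    exact this
  · intro Φ
    choose ext hext using fun (x : M) (f : DualBundle V x) =>
      exists_section_eq (I := I) (F := F →L[ℝ] ℝ) (V := DualBundle V) f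
    let L : ∀ x, Module.Dual ℝ (Module.Dual ℝ (V x)) := fun x =>
      { toFun := fun f => Φ (ext x (LinearMap.toContinuousLinearMap f)) x
        map_add' := fun f g => by
          have := functional_tensorial Φ (x₀ := x)
            (X := ext x (LinearMap.toContinuousLinearMap (f + g)))
            (Y := ext x (LinearMap.toContinuousLinearMap f) +
              ext x (LinearMap.toContinuousLinearMap g)) (by simp [hext])
          rw [this, map_add]; rfl
        map_smul' := fun r f => by
          have := functional_tensorial Φ (x₀ := x)
            (X := ext x (LinearMap.toContinuousLinearMap (r • f)))
            (Y := (ContMDiffMap.const r : Fun I M) •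
              ext x (LinearMap.toContinuousLinearMap f)) (by simp [hext]; rfl)
          rw [this, map_smul]; rfl }
    let X : ∀ x, V x := fun x => (Module.evalEquiv ℝ (V x)).symm (L x)
    have hX : ∀ (ξ : DualSec I F V) x, ξ x (X x) = Φ ξ x := fun ξ x => by
      have h1 : (ξ x : V x →ₗ[ℝ] ℝ) (X x) = L x (ξ x : V x →ₗ[ℝ] ℝ) :=
        Module.apply_evalEquiv_symm_apply ..
      refine h1.trans (functional_tensorial Φ ?_)
      rw [hext]
      rfl
    have : ContMDiffVectorBundle 1 F V I := ContMDiffVectorBundle.of_le (n := ∞) (by simp)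
    refine ⟨⟨X, fun x₀ => ?_⟩, ?_⟩
    · let b := Module.finBasis ℝ F
      let e := trivializationAt F V x₀
      have hx₀ : x₀ ∈ e.baseSet := FiberBundle.mem_baseSet_trivializationAt' x₀
      rw [contMDiffAt_iff_localFrameCoeff (k := ∞) b (e := e) hx₀]
      intro i
      obtain ⟨χ, h1, h2⟩ := exists_bump (I := I) x₀ (e.open_baseSet.mem_nhds hx₀)
      let ε : DualSec I F V :=
        ⟨fun x => LinearMap.toContinuousLinearMap (χ x • e.localFrameCoeff I b i x),
          contMDiff_hom_of_apply _ fun Z => (contMDiff_trivial_iff _).2 <| by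
            have hc := contMDiffOn_baseSet_localFrameCoeff (e := e) (k := ∞) b
              (Z.contMDiff.contMDiffOn) i
            refine contMDiff_of_contMDiffOn_union_of_isOpen
              (χ.contMDiff.contMDiffOn.mul hc) (t := (tsupport χ)ᶜ) ?_ ?_ e.open_baseSet
              (isClosed_tsupport _).isOpen_compl
            · refine (contMDiffOn_const (c := (0 : ℝ))).congr fun y hy => ?_
              simp [image_eq_zero_of_notMem_tsupport hy]
            · exact Set.compl_subset_iff_union.mp <| Set.compl_subset_compl.mpr h2⟩
      refine ((Φ ε).contMDiff x₀).congr_of_eventuallyEq ?_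
      filter_upwards [h1] with x hx
      rw [← hX]
      simp [ε, hx, LinearMap.piApply]
    · ext ξ x
      exact hX ξ x

/-- `Γ(V*)` is the `C^∞(M)`-dual of `Γ(V)`, through the duality pairing. -/
def dualEquiv : DualSec I F V ≃ₗ[Fun I M]
    (Sec I F V →ₗ[Fun I M] Fun I M) :=
  LinearEquiv.ofBijective _ pairing_bijective

/-- `Γ(V)` is the `C^∞(M)`-dual of `Γ(V*)`, through the duality pairing. -/
def bidualEquiv : Sec I F V ≃ₗ[Fun I M]
    (DualSec I F V →ₗ[Fun I M] Fun I M) :=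
  LinearEquiv.ofBijective _ pairing_flip_bijective

theorem pairing_dualEquiv_symm
    (θ : Sec I F V →ₗ[Fun I M] Fun I M) (X : Sec I F V) :
    pairing (dualEquiv.symm θ) X = θ X :=
  LinearMap.congr_fun (dualEquiv.apply_symm_apply θ) X

theorem pairing_bidualEquiv_symm (ξ : DualSec I F V)
    (φ : DualSec I F V →ₗ[Fun I M] Fun I M) :
    pairing ξ (bidualEquiv.symm φ) = φ ξ :=
  LinearMap.congr_fun (bidualEquiv.apply_symm_apply φ) ξ

end

/-! ### Lie algebroids -/

section LieAlgebroid
variable [IsManifold I ∞ M]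

/-- The derivative `Z · f` of a smooth function along a vector field. -/
def vectorDeriv (Z : Sec I E (TangentSpace I : M → Type _)) (f : Fun I M) :
    Fun I M :=
  ⟨fun x => mfderiv I 𝓘(ℝ) f x (Z x), by
    have h1 : ContMDiff I.tangent 𝓘(ℝ).tangent ∞ (tangentMap I 𝓘(ℝ) f) :=
      f.contMDiff.contMDiff_tangentMap (by simp)
    have h2 := h1.comp Z.contMDiff
    exact (contMDiff_snd_tangentBundle_modelSpace ℝ 𝓘(ℝ)).comp h2⟩

@[simp] theorem vectorDeriv_apply (Z : Sec I E (TangentSpace I : M → Type _))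
    (f : Fun I M) (x : M) : vectorDeriv Z f x = mfderiv I 𝓘(ℝ) f x (Z x) := rfl

theorem vectorDeriv_add (Z : Sec I E (TangentSpace I : M → Type _))
    (f g : Fun I M) : vectorDeriv Z (f + g) = vectorDeriv Z f + vectorDeriv Z g := by
  ext x
  have h := (f.contMDiff.mdifferentiable (by simp) x).hasMFDerivAt.add
    (g.contMDiff.mdifferentiable (by simp) x).hasMFDerivAt
  exact congrArg (fun A : E →L[ℝ] ℝ => A (Z x)) h.mfderiv

theorem vectorDeriv_mul (Z : Sec I E (TangentSpace I : M → Type _))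
    (f g : Fun I M) :
    vectorDeriv Z (f * g) = f * vectorDeriv Z g + g * vectorDeriv Z f := by
  ext x
  have h := (f.contMDiff.mdifferentiable (by simp) x).hasMFDerivAt.mul
    (g.contMDiff.mdifferentiable (by simp) x).hasMFDerivAt
  exact congrArg (fun A : E →L[ℝ] ℝ => A (Z x)) h.mfderiv

theorem vectorDeriv_add_left (Z Z' : Sec I E (TangentSpace I : M → Type _))
    (f : Fun I M) : vectorDeriv (Z + Z') f = vectorDeriv Z f + vectorDeriv Z' f := by
  ext x
  exact map_add (mfderiv I 𝓘(ℝ) f x) (Z x) (Z' x)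

theorem vectorDeriv_smul_left (g : Fun I M)
    (Z : Sec I E (TangentSpace I : M → Type _)) (f : Fun I M) :
    vectorDeriv (g • Z) f = g * vectorDeriv Z f := by
  ext x
  exact map_smul (mfderiv I 𝓘(ℝ) f x) (g x) (Z x)

/-- A Lie algebroid structure on `V`: a Lie bracket on sections and an anchor `ρ : V → TM`, related
by the Leibniz rule. (That `ρ` maps brackets to brackets of vector fields is a consequence.) -/
structure LieAlgebroid (I : ModelWithCorners ℝ E H) [IsManifold I ∞ M]
    (F : Type*) [NormedAddCommGroup F] [NormedSpace ℝ F]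
    (V : M → Type*) [TopologicalSpace (TotalSpace F V)] [∀ x, TopologicalSpace (V x)]
    [∀ x, AddCommGroup (V x)] [∀ x, Module ℝ (V x)] [FiberBundle F V] [VectorBundle ℝ F V] where
  bracket : Sec I F V →ₗ[ℝ] Sec I F V →ₗ[ℝ] Sec I F V
  anchor : BundleHom I F V E (TangentSpace I : M → Type _)
  bracket_self : ∀ X, bracket X X = 0
  jacobi : ∀ X Y Z, bracket X (bracket Y Z) = bracket (bracket X Y) Z + bracket Y (bracket X Z)
  leibniz : ∀ (X Y : Sec I F V) (f : Fun I M),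
    bracket X (f • Y) = f • bracket X Y + vectorDeriv (anchor.map X) f • Y

namespace LieAlgebroid

variable (L : LieAlgebroid I F V)

/-- The derivative `ρ(X) · f` of a function along the anchor of a section. -/
def rho (X : Sec I F V) (f : Fun I M) : Fun I M :=
  vectorDeriv (L.anchor.map X) f

theorem bracket_smul (X Y : Sec I F V) (f : Fun I M) :
    L.bracket X (f • Y) = f • L.bracket X Y + L.rho X f • Y :=
  L.leibniz X Y f

theorem rho_add (X : Sec I F V) (f g : Fun I M) :
    L.rho X (f + g) = L.rho X f + L.rho X g := vectorDeriv_add ..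

theorem rho_mul (X : Sec I F V) (f g : Fun I M) :
    L.rho X (f * g) = f * L.rho X g + g * L.rho X f := vectorDeriv_mul ..

theorem rho_add_left (X Y : Sec I F V) (f : Fun I M) :
    L.rho (X + Y) f = L.rho X f + L.rho Y f := by
  simp only [rho, map_add, vectorDeriv_add_left]

theorem rho_smul_left (g : Fun I M) (X : Sec I F V) (f : Fun I M) :
    L.rho (g • X) f = g * L.rho X f := by
  simp only [rho, map_smul, vectorDeriv_smul_left]

/-- The differential `d f`, as a linear form on sections: `⟨d f, X⟩ = ρ(X) · f`. -/
def dFun (f : Fun I M) :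
    Sec I F V →ₗ[Fun I M] Fun I M where
  toFun X := L.rho X f
  map_add' X Y := L.rho_add_left X Y f
  map_smul' g X := L.rho_smul_left g X f

/-- The Lie derivative `L_X θ` of a 1-form:
`⟨L_X θ, Y⟩ = ρ(X) · ⟨θ, Y⟩ - ⟨θ, [X, Y]⟩`. -/
def lieForm (X : Sec I F V)
    (θ : Sec I F V →ₗ[Fun I M] Fun I M) :
    Sec I F V →ₗ[Fun I M] Fun I M where
  toFun Y := L.rho X (θ Y) - θ (L.bracket X Y)
  map_add' Y Z := by
    simp only [map_add, rho_add]
    ring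
  map_smul' f Y := by
    simp only [map_smul, bracket_smul, map_add, smul_eq_mul, rho_mul, RingHom.id_apply]
    ring

/-- The contraction `i_X d θ` of the Lie algebroid differential of a 1-form:
`(d θ)(X, Y) = ρ(X) · ⟨θ, Y⟩ - ρ(Y) · ⟨θ, X⟩ - ⟨θ, [X, Y]⟩`. -/
def contrD (X : Sec I F V)
    (θ : Sec I F V →ₗ[Fun I M] Fun I M) :
    Sec I F V →ₗ[Fun I M] Fun I M where
  toFun Y := L.rho X (θ Y) - L.rho Y (θ X) - θ (L.bracket X Y)
  map_add' Y Z := by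
    simp only [map_add, rho_add, rho_add_left]
    ring
  map_smul' f Y := by
    simp only [map_smul, bracket_smul, map_add, smul_eq_mul, rho_mul, rho_smul_left,
      RingHom.id_apply]
    ring

end LieAlgebroid
end LieAlgebroid

/-! ### Whitney sums and endomorphisms -/

section Prod

theorem contMDiff_prod_section_iff (s : ∀ x, V x) (t : ∀ x, W x) :
    ContMDiff I (I.prod 𝓘(ℝ, F × G)) ∞
        (fun x => TotalSpace.mk' (F × G) (E := fun x => V x × W x) x (s x, t x)) ↔
      ContMDiff I (I.prod 𝓘(ℝ, F)) ∞ (fun x => TotalSpace.mk' F x (s x)) ∧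
      ContMDiff I (I.prod 𝓘(ℝ, G)) ∞ (fun x => TotalSpace.mk' G x (t x)) := by
  simp only [ContMDiff, ← forall_and]
  refine forall_congr' fun x => ?_
  rw [contMDiffAt_section, contMDiffAt_section, contMDiffAt_section]
  exact contMDiffAt_prod_module_iff _

/-- The section `X + ξ` of a Whitney sum. -/
def prodMk (X : Sec I F V) (ξ : Sec I G W) :
    Sec I (F × G) (fun x => V x × W x) :=
  ⟨fun x => (X x, ξ x), (contMDiff_prod_section_iff _ _).2 ⟨X.contMDiff, ξ.contMDiff⟩⟩

/-- First component of a section of a Whitney sum. -/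
def prodFst (u : Sec I (F × G) (fun x => V x × W x)) : Sec I F V :=
  ⟨fun x => (u x).1, ((contMDiff_prod_section_iff _ _).1 u.contMDiff).1⟩

/-- Second component of a section of a Whitney sum. -/
def prodSnd (u : Sec I (F × G) (fun x => V x × W x)) : Sec I G W :=
  ⟨fun x => (u x).2, ((contMDiff_prod_section_iff _ _).1 u.contMDiff).2⟩

end Prod

section Endo

variable [FiniteDimensional ℝ E] [T2Space M] [IsManifold I ∞ M]
  [FiniteDimensional ℝ F] [ContMDiffVectorBundle ∞ F V I]
  [∀ x, IsTopologicalAddGroup (V x)] [∀ x, ContinuousSMul ℝ (V x)]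

/-- The transpose `ᵗN : V* → V*` of an endomorphism `N` of `V`: `ᵗN ξ = ξ ∘ N`. -/
def transpose (N : BundleHom I F V F V) :
    BundleHom I (F →L[ℝ] ℝ) (DualBundle V) (F →L[ℝ] ℝ) (DualBundle V) :=
  ⟨fun x => ContinuousLinearMap.precomp (Trivial M ℝ x) (N x),
    contMDiff_hom_of_apply _ fun ξ => contMDiff_hom_of_apply _ fun X =>
      ξ.contMDiff.clm_bundle_apply (N.contMDiff.clm_bundle_apply X.contMDiff)⟩

/-- The endomorphism `diag(N, -ᵗN)` of `V ⊕ V*`. -/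
def doubleEndo (N : BundleHom I F V F V) :
    BundleHom I (F × (F →L[ℝ] ℝ)) (DoubleBundle V) (F × (F →L[ℝ] ℝ)) (DoubleBundle V) :=
  ⟨fun x => (N x).prodMap (-(transpose N x)),
    contMDiff_hom_of_apply _ fun u => (contMDiff_prod_section_iff _ _).2
      ⟨(N.map (prodFst u)).contMDiff, (-((transpose N).map (prodSnd u))).contMDiff⟩⟩

end Endo

/-! ### Almost cps structures and Nijenhuis torsion -/

section Cps

variable [∀ x, IsTopologicalAddGroup (V x)] [∀ x, ContinuousSMul ℝ (V x)]

/-- Almost complex (`ε = -1`), almost paracomplex (`ε = 1`) or almost subtangent (`ε = 0`)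
structures on a vector bundle: `J² = ε Id`. -/
def IsAlmostCps (J : BundleHom I F V F V) : Prop :=
  ∃ ε : ℝ, (ε = -1 ∨ ε = 1 ∨ ε = 0) ∧ ∀ (x : M) (v : V x), J x (J x v) = ε • v

/-- `N` is a constant real multiple of an almost cps structure. -/
def IsProportionalToAlmostCps (N : BundleHom I F V F V) : Prop :=
  ∃ (c : ℝ) (J : BundleHom I F V F V), IsAlmostCps J ∧ N = c • J

end Cps

/-- The Nijenhuis torsion `(T N)(u, v) = [N u, N v] - N ([N u, v] + [u, N v] - N [u, v])` of an
operator `N` with respect to a bracket. -/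
def torsion {S : Type*} [AddCommGroup S] (br : S → S → S) (N : S → S) (u v : S) : S :=
  br (N u) (N v) - N (br (N u) v + br u (N v) - N (br u v))

/-- Nijenhuis tensors of a vector bundle `W` with a fibrewise symmetric bilinear form and a bracket
on sections: skew-symmetric endomorphisms with vanishing torsion. -/
structure IsNijenhuisTensor [∀ x, IsTopologicalAddGroup (W x)] [∀ x, ContinuousSMul ℝ (W x)]
    (form : Sec I G W → Sec I G W → Fun I M) (br : Sec I G W → Sec I G W → Sec I G W)
    (N : BundleHom I G W G W) : Prop where
  skew : ∀ u v, form (BundleHom.map N u) v + form u (BundleHom.map N v) = 0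
  torsion_eq_zero : ∀ u v, torsion br (BundleHom.map N) u v = 0

/-! ### Lie bialgebroids and their doubles -/

section Double

variable [FiniteDimensional ℝ E] [T2Space M] [IsManifold I ∞ M]
  [FiniteDimensional ℝ F] [ContMDiffVectorBundle ∞ F V I]

/-- `d_μ f` as a section of `V*`, for a Lie algebroid `(V, μ)`. -/
def dMu (μ : LieAlgebroid I F V) (f : Fun I M) : DualSec I F V :=
  dualEquiv.symm (μ.dFun f)

/-- `L^μ_X η` as a section of `V*`. -/
def lieMu (μ : LieAlgebroid I F V) (X : Sec I F V) (η : DualSec I F V) : DualSec I F V :=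
  dualEquiv.symm (μ.lieForm X (dualEquiv η))

/-- `i_X d_μ η` as a section of `V*`. -/
def contrMu (μ : LieAlgebroid I F V) (X : Sec I F V) (η : DualSec I F V) : DualSec I F V :=
  dualEquiv.symm (μ.contrD X (dualEquiv η))

/-- `d_γ f` as a section of `V`, for a Lie algebroid `(V*, γ)`. -/
def dGamma (γ : LieAlgebroid I (F →L[ℝ] ℝ) (DualBundle V)) (f : Fun I M) : Sec I F V :=
  bidualEquiv.symm (γ.dFun f)

/-- `L^γ_ξ Y` as a section of `V`. -/
def lieGamma (γ : LieAlgebroid I (F →L[ℝ] ℝ) (DualBundle V)) (ξ : DualSec I F V)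
    (Y : Sec I F V) : Sec I F V :=
  bidualEquiv.symm (γ.lieForm ξ (bidualEquiv Y))

/-- `i_ξ d_γ Y` as a section of `V`. -/
def contrGamma (γ : LieAlgebroid I (F →L[ℝ] ℝ) (DualBundle V)) (ξ : DualSec I F V)
    (Y : Sec I F V) : Sec I F V :=
  bidualEquiv.symm (γ.contrD ξ (bidualEquiv Y))

/-- The bivector `d_γ X` evaluated on `(ξ, η)`. -/
def dGammaEval (γ : LieAlgebroid I (F →L[ℝ] ℝ) (DualBundle V)) (X : Sec I F V)
    (ξ η : DualSec I F V) : Fun I M :=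
  γ.contrD ξ (bidualEquiv X) η

/-- The bivector `L^μ_X (d_γ Y) = [X, d_γ Y]_μ` evaluated on `(ξ, η)`. -/
def lieDGammaEval (μ : LieAlgebroid I F V) (γ : LieAlgebroid I (F →L[ℝ] ℝ) (DualBundle V))
    (X Y : Sec I F V) (ξ η : DualSec I F V) : Fun I M :=
  μ.rho X (dGammaEval γ Y ξ η) - dGammaEval γ Y (lieMu μ X ξ) η - dGammaEval γ Y ξ (lieMu μ X η)

/-- Lie algebroid structures `μ` on `V` and `γ` on `V*` form a Lie bialgebroid if `d_γ` is a
derivation of the Schouten bracket of `μ` on `Γ(∧ V)`. The three fields are the derivation rule on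
the generators, that is, for two functions, a section and a function, and two sections; they are
the three homogeneous components of `{μ, γ} = 0`. -/
structure IsLieBialgebroid (μ : LieAlgebroid I F V)
    (γ : LieAlgebroid I (F →L[ℝ] ℝ) (DualBundle V)) : Prop where
  /-- `0 = d_γ [f, g] = [d_γ f, g] - [f, d_γ g]`, up to the overall sign. -/
  fun_fun : ∀ f g : Fun I M, μ.rho (dGamma γ f) g + μ.rho (dGamma γ g) f = 0
  /-- `d_γ [X, f] = [X, d_γ f] + [d_γ X, f]`, where `[P, f] = - i_{d f} P` for a bivector `P`. -/
  sec_fun : ∀ (X : Sec I F V) (f : Fun I M),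
    dGamma γ (μ.rho X f) = μ.bracket X (dGamma γ f) - contrGamma γ (dMu μ f) X
  /-- `d_γ [X, Y] = [X, d_γ Y] + [d_γ X, Y]`. -/
  sec_sec : ∀ (X Y : Sec I F V) (ξ η : DualSec I F V),
    dGammaEval γ (μ.bracket X Y) ξ η = lieDGammaEval μ γ X Y ξ η - lieDGammaEval μ γ Y X ξ η

/-- The canonical symmetric form of `V ⊕ V*`: `⟨X + ξ, Y + η⟩ = ⟨ξ, Y⟩ + ⟨η, X⟩`. -/
def doubleForm (u v : DoubleSec I F V) : Fun I M :=
  pairing (prodSnd u) (prodFst v) + pairing (prodSnd v) (prodFst u)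

/-- The Dorfman bracket of the double of `(V, μ)` and `(V*, γ)`, that is, the derived bracket
`{{u, μ + γ}, v}`. For `u = X + ξ` and `v = Y + η` it is
`[X, Y]_μ + L^γ_ξ Y - i_η d_γ X + [ξ, η]_γ + L^μ_X η - i_Y d_μ ξ`. -/
def doubleBracket (μ : LieAlgebroid I F V) (γ : LieAlgebroid I (F →L[ℝ] ℝ) (DualBundle V))
    (u v : DoubleSec I F V) : DoubleSec I F V :=
  prodMk
    (μ.bracket (prodFst u) (prodFst v) + lieGamma γ (prodSnd u) (prodFst v)
      - contrGamma γ (prodSnd v) (prodFst u))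
    (γ.bracket (prodSnd u) (prodSnd v) + lieMu μ (prodFst u) (prodSnd v)
      - contrMu μ (prodFst v) (prodSnd u))

end Double

end LieBialg

end

set_option linter.unusedSectionVars false

namespace LieBialg

/-! ### Torsion identities in a single Lie algebroid -/

section LieAlgebroid

variable {E : Type*} [NormedAddCommGroup E] [NormedSpace ℝ E]
  {H : Type*} [TopologicalSpace H] {I : ModelWithCorners ℝ E H}
  {M : Type*} [TopologicalSpace M] [ChartedSpace H M] [IsManifold I ∞ M]
  {F : Type*} [NormedAddCommGroup F] [NormedSpace ℝ F]
  {V : M → Type*} [TopologicalSpace (TotalSpace F V)] [∀ x, TopologicalSpace (V x)]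
  [∀ x, AddCommGroup (V x)] [∀ x, Module ℝ (V x)] [FiberBundle F V] [VectorBundle ℝ F V]

/-! Everything rests on N² = r Id with r = c²ε a real constant. The bracket is ℝ-bilinear, so [X,
N²Y] = N²[X, Y], and vanishing torsion reads [NX, NY] + r[X, Y] = N([NX, Y] + [X, NY])
(`torsion_of_sq`).

By biadditivity the torsion of diag(N, -ᵗN) for the double bracket splits into two pure terms, the
torsions of N for μ and of ᵗN for γ, and four mixed terms, one for each of L^μ, i d_μ, L^γ, i d_γ.
The pure terms vanish by hypothesis.

Paired with a test section, a mixed term becomes a 1-form θ applied to a torsion. For the Lie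
derivative the anchor terms cancel, and what remains is θ of [NX, NY] + [X, N²Y] - N[NX, Y] - N[X,
NY]. This is the torsion with N²[X, Y] replaced by [X, N²Y], so it vanishes (`lieForm_torsion`). For
i d there are also ρ(Y)·θ(N²X) and ρ(N²Y)·θ(X), which agree because r has zero derivative
(`contrD_torsion`).

These two identities are proved for an arbitrary Lie algebroid and a C^∞-linear operator K. They
therefore serve both (A, μ, N) and (A*, γ, ᵗN), A being the dual of A* and N the transpose of ᵗN. -/

theorem const_smul_section (r : ℝ) (X : Sec I F V) :
    (ContMDiffMap.const r : Fun I M) • X = r • X := rfl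

/-- The Leibniz term carrying the derivative of r drops out. This is where constancy of the scalar
N² matters for the contraction terms. -/
theorem vectorDeriv_const_mul (Z : Sec I E (TangentSpace I : M → Type _)) (r : ℝ) (f : Fun I M) :
    vectorDeriv Z ((ContMDiffMap.const r : Fun I M) * f) =
      (ContMDiffMap.const r : Fun I M) * vectorDeriv Z f := by
  have h : vectorDeriv Z (ContMDiffMap.const r : Fun I M) = 0 := by
    ext x
    change mfderiv I 𝓘(ℝ) (fun _ : M => r) x (Z x) = 0
    rw [mfderiv_const]
    rfl
  rw [vectorDeriv_mul, h, mul_zero, add_zero]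

namespace LieAlgebroid

variable (L : LieAlgebroid I F V) {K : Sec I F V →ₗ[Fun I M] Sec I F V} {r : ℝ}

theorem rho_neg_left (X : Sec I F V) (f : Fun I M) : L.rho (-X) f = -L.rho X f :=
  map_neg (L.dFun f) X

theorem rho_neg (X : Sec I F V) (f : Fun I M) : L.rho X (-f) = -L.rho X f :=
  map_neg (AddMonoidHom.mk' (L.rho X) (L.rho_add X)) f

theorem lieForm_neg_left (X : Sec I F V) (θ : Sec I F V →ₗ[Fun I M] Fun I M) :
    L.lieForm (-X) θ = -L.lieForm X θ := by
  refine LinearMap.ext fun Y => ?_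
  simp only [lieForm, LinearMap.coe_mk, AddHom.coe_mk, LinearMap.neg_apply, rho_neg_left, map_neg]
  ring

theorem lieForm_neg (X : Sec I F V) (θ : Sec I F V →ₗ[Fun I M] Fun I M) :
    L.lieForm X (-θ) = -L.lieForm X θ := by
  refine LinearMap.ext fun Y => ?_
  simp only [lieForm, LinearMap.coe_mk, AddHom.coe_mk, LinearMap.neg_apply, rho_neg]
  ring

theorem contrD_neg_left (X : Sec I F V) (θ : Sec I F V →ₗ[Fun I M] Fun I M) :
    L.contrD (-X) θ = -L.contrD X θ := by
  refine LinearMap.ext fun Y => ?_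
  simp only [contrD, LinearMap.coe_mk, AddHom.coe_mk, LinearMap.neg_apply, rho_neg_left, rho_neg,
    map_neg]
  ring

theorem contrD_neg (X : Sec I F V) (θ : Sec I F V →ₗ[Fun I M] Fun I M) :
    L.contrD X (-θ) = -L.contrD X θ := by
  refine LinearMap.ext fun Y => ?_
  simp only [contrD, LinearMap.coe_mk, AddHom.coe_mk, LinearMap.neg_apply, rho_neg]
  ring

/-- Since K² is the scalar r, the term K²[X, Y] of the torsion is r[X, Y]. The scalar is written as
a constant function so that a C^∞-linear form can be moved past it. -/
theorem torsion_of_sq (hsq : ∀ X, K (K X) = r • X)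
    (hT : ∀ X Y, torsion (fun X Y => L.bracket X Y) K X Y = 0) (X Y : Sec I F V) :
    L.bracket (K X) (K Y) + (ContMDiffMap.const r : Fun I M) • L.bracket X Y =
      K (L.bracket (K X) Y) + K (L.bracket X (K Y)) := by
  have h := hT X Y
  simp only [torsion, map_sub, map_add, hsq, sub_eq_zero] at h
  rw [h, const_smul_section]
  abel

/-- The torsion of the pair `(K, -ᵗK)` for the Lie derivative of 1-forms vanishes. -/
theorem lieForm_torsion (hsq : ∀ X, K (K X) = r • X)
    (hT : ∀ X Y, torsion (fun X Y => L.bracket X Y) K X Y = 0)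
    (θ : Sec I F V →ₗ[Fun I M] Fun I M) (X Y : Sec I F V) :
    L.lieForm (K X) (θ ∘ₗ K) Y + L.lieForm X (θ ∘ₗ K) (K Y) =
      L.lieForm (K X) θ (K Y) + L.lieForm X θ (K (K Y)) := by
  have h := congrArg θ (L.torsion_of_sq hsq hT X Y)
  simp only [map_add, map_smul, smul_eq_mul] at h
  have h2 : L.bracket X (r • Y) = (ContMDiffMap.const r : Fun I M) • L.bracket X Y :=
    map_smul (L.bracket X) r Y
  simp only [lieForm, LinearMap.coe_mk, AddHom.coe_mk, LinearMap.comp_apply, hsq, h2, map_smul,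
    smul_eq_mul]
  -- The anchor terms on the two sides coincide; the bracket terms differ by θ of the torsion
  -- identity.
  linear_combination h

/-- The torsion of the pair `(K, -ᵗK)` for the contraction with the differential of 1-forms
vanishes. -/
theorem contrD_torsion (hsq : ∀ X, K (K X) = r • X)
    (hT : ∀ X Y, torsion (fun X Y => L.bracket X Y) K X Y = 0)
    (θ : Sec I F V →ₗ[Fun I M] Fun I M) (X Y : Sec I F V) :
    L.contrD (K X) (θ ∘ₗ K) Y + L.contrD X (θ ∘ₗ K) (K Y) =
      L.contrD (K X) θ (K Y) + L.contrD X θ (K (K Y)) := by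
  have h := congrArg θ (L.torsion_of_sq hsq hT X Y)
  simp only [map_add, map_smul, smul_eq_mul] at h
  have h2 : L.bracket X (r • Y) = (ContMDiffMap.const r : Fun I M) • L.bracket X Y :=
    map_smul (L.bracket X) r Y
  -- Besides the terms of the Lie derivative there are ρ(Y)·θ(K²X) and ρ(K²Y)·θ(X). Both equal r
  -- ρ(Y)·θ(X): the first because r is constant, the second by linearity of the anchor.
  have h3 : θ (r • X) = (ContMDiffMap.const r : Fun I M) * θ X := by
    rw [← const_smul_section, map_smul, smul_eq_mul]
  have h4 : L.rho (r • Y) (θ X) = (ContMDiffMap.const r : Fun I M) * L.rho Y (θ X) := by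
    rw [← const_smul_section, rho_smul_left]
  have h5 : L.rho Y ((ContMDiffMap.const r : Fun I M) * θ X) =
      (ContMDiffMap.const r : Fun I M) * L.rho Y (θ X) := vectorDeriv_const_mul ..
  simp only [contrD, LinearMap.coe_mk, AddHom.coe_mk, LinearMap.comp_apply, hsq, h2, h3, h4, h5,
    map_smul, smul_eq_mul]
  linear_combination h

end LieAlgebroid

end LieAlgebroid

section Double

variable {E : Type*} [NormedAddCommGroup E] [NormedSpace ℝ E] [FiniteDimensional ℝ E]
  {H : Type*} [TopologicalSpace H] {I : ModelWithCorners ℝ E H}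
  {M : Type*} [TopologicalSpace M] [ChartedSpace H M] [IsManifold I ∞ M] [T2Space M]
  {F : Type*} [NormedAddCommGroup F] [NormedSpace ℝ F] [FiniteDimensional ℝ F]
  {A : M → Type*} [TopologicalSpace (TotalSpace F A)] [∀ x, TopologicalSpace (A x)]
  [∀ x, AddCommGroup (A x)] [∀ x, Module ℝ (A x)]
  [FiberBundle F A] [VectorBundle ℝ F A] [ContMDiffVectorBundle ∞ F A I]
  (μ : LieAlgebroid I F A) (γ : LieAlgebroid I (F →L[ℝ] ℝ) (DualBundle A))

/-! ### Pairings that characterise the mixed operations of the double -/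

theorem pairing_lieMu (X Y : Sec I F A) (η : DualSec I F A) :
    pairing (lieMu μ X η) Y = μ.lieForm X (dualEquiv η) Y :=
  pairing_dualEquiv_symm _ _

theorem pairing_contrMu (X Y : Sec I F A) (η : DualSec I F A) :
    pairing (contrMu μ X η) Y = μ.contrD X (dualEquiv η) Y :=
  pairing_dualEquiv_symm _ _

theorem pairing_lieGamma (ξ ζ : DualSec I F A) (Y : Sec I F A) :
    pairing ζ (lieGamma γ ξ Y) = γ.lieForm ξ (bidualEquiv Y) ζ :=
  pairing_bidualEquiv_symm _ _

theorem pairing_contrGamma (ξ ζ : DualSec I F A) (Y : Sec I F A) :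
    pairing ζ (contrGamma γ ξ Y) = γ.contrD ξ (bidualEquiv Y) ζ :=
  pairing_bidualEquiv_symm _ _

/-! ### Transposes, signs and squares -/

variable [∀ x, IsTopologicalAddGroup (A x)] [∀ x, ContinuousSMul ℝ (A x)]
  {N : BundleHom I F A F A} {r : ℝ}

theorem dualEquiv_map (N : BundleHom I F A F A) (η : DualSec I F A) :
    dualEquiv ((transpose N).map η) = dualEquiv η ∘ₗ N.map := rfl

/-- Under A = A**, N is the transpose of ᵗN, so statements about 1-forms on (A*, γ) apply with ᵗN in
the role of K. -/
theorem bidualEquiv_map (N : BundleHom I F A F A) (Y : Sec I F A) :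
    bidualEquiv (N.map Y) = bidualEquiv Y ∘ₗ (transpose N).map := rfl

theorem pairing_transpose (N : BundleHom I F A F A) (ξ : DualSec I F A) (X : Sec I F A) :
    pairing ((transpose N).map ξ) X = pairing ξ (N.map X) := rfl

theorem lieMu_neg_right (X : Sec I F A) (η : DualSec I F A) :
    lieMu μ X (-η) = -lieMu μ X η := by
  rw [lieMu, map_neg, LieAlgebroid.lieForm_neg, map_neg, lieMu]

theorem contrMu_neg_right (X : Sec I F A) (η : DualSec I F A) :
    contrMu μ X (-η) = -contrMu μ X η := by
  rw [contrMu, map_neg, LieAlgebroid.contrD_neg, map_neg, contrMu]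

theorem lieGamma_neg_left (ξ : DualSec I F A) (Y : Sec I F A) :
    lieGamma γ (-ξ) Y = -lieGamma γ ξ Y := by
  rw [lieGamma, LieAlgebroid.lieForm_neg_left, map_neg, lieGamma]

theorem contrGamma_neg_left (ξ : DualSec I F A) (Y : Sec I F A) :
    contrGamma γ (-ξ) Y = -contrGamma γ ξ Y := by
  rw [contrGamma, LieAlgebroid.contrD_neg_left, map_neg, contrGamma]

theorem IsProportionalToAlmostCps.exists_sq {N : BundleHom I F A F A}
    (hN : IsProportionalToAlmostCps N) : ∃ r : ℝ, ∀ X, N.map (N.map X) = r • X := by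
  obtain ⟨c, J, ⟨ε, -, hJ⟩, rfl⟩ := hN
  -- (cJ)² = c²J² = c²ε Id.
  refine ⟨c * c * ε, fun X => ?_⟩
  ext x
  change c • J x (c • J x (X x)) = (c * c * ε) • X x
  rw [map_smul, hJ, smul_smul, smul_smul]

theorem transpose_sq (hsq : ∀ X, N.map (N.map X) = r • X) (ξ : DualSec I F A) :
    (transpose N).map ((transpose N).map ξ) = r • ξ := by
  refine pairing_bijective.1 (LinearMap.ext fun X => ?_)
  rw [pairing_transpose, pairing_transpose, hsq, ← const_smul_section, ← const_smul_section,
    map_smul, map_smul, LinearMap.smul_apply]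

variable {μ γ}

/-! ### Vanishing of the four mixed terms -/

/-- Each transpose outside L^μ moves onto the test section Y, and each one inside precomposes the
1-form with N. The identity is then the one for `lieForm`, with θ = η. -/
theorem lieMu_torsion (hsq : ∀ X, N.map (N.map X) = r • X)
    (hμ : ∀ X Y, torsion (fun X Y => μ.bracket X Y) N.map X Y = 0)
    (X : Sec I F A) (η : DualSec I F A) :
    lieMu μ (N.map X) ((transpose N).map η) +
        (transpose N).map (lieMu μ X ((transpose N).map η)) =
      (transpose N).map (lieMu μ (N.map X) η) +
        (transpose N).map ((transpose N).map (lieMu μ X η)) := by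
  refine pairing_bijective.1 (LinearMap.ext fun Y => ?_)
  simp only [map_add, LinearMap.add_apply, pairing_transpose, pairing_lieMu, dualEquiv_map]
  exact μ.lieForm_torsion hsq hμ _ X Y

theorem contrMu_torsion (hsq : ∀ X, N.map (N.map X) = r • X)
    (hμ : ∀ X Y, torsion (fun X Y => μ.bracket X Y) N.map X Y = 0)
    (X : Sec I F A) (η : DualSec I F A) :
    contrMu μ (N.map X) ((transpose N).map η) +
        (transpose N).map (contrMu μ X ((transpose N).map η)) =
      (transpose N).map (contrMu μ (N.map X) η) +
        (transpose N).map ((transpose N).map (contrMu μ X η)) := by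
  refine pairing_bijective.1 (LinearMap.ext fun Y => ?_)
  simp only [map_add, LinearMap.add_apply, pairing_transpose, pairing_contrMu, dualEquiv_map]
  exact μ.contrD_torsion hsq hμ _ X Y

/-- Dual to the case of μ: Y is read as a 1-form on A*, the test section ζ lies in A*, and ᵗN has
the same constant square as N. -/
theorem lieGamma_torsion (hsq : ∀ X, N.map (N.map X) = r • X)
    (hγ : ∀ ξ η, torsion (fun ξ η => γ.bracket ξ η) (transpose N).map ξ η = 0)
    (ξ : DualSec I F A) (Y : Sec I F A) :
    lieGamma γ ((transpose N).map ξ) (N.map Y) + N.map (lieGamma γ ξ (N.map Y)) =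
      N.map (lieGamma γ ((transpose N).map ξ) Y) + N.map (N.map (lieGamma γ ξ Y)) := by
  refine pairing_flip_bijective.1 (LinearMap.ext fun ζ => ?_)
  simp only [map_add, LinearMap.add_apply, LinearMap.flip_apply, ← pairing_transpose,
    pairing_lieGamma, bidualEquiv_map]
  exact γ.lieForm_torsion (transpose_sq hsq) hγ _ ξ ζ

theorem contrGamma_torsion (hsq : ∀ X, N.map (N.map X) = r • X)
    (hγ : ∀ ξ η, torsion (fun ξ η => γ.bracket ξ η) (transpose N).map ξ η = 0)
    (ξ : DualSec I F A) (Y : Sec I F A) :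
    contrGamma γ ((transpose N).map ξ) (N.map Y) + N.map (contrGamma γ ξ (N.map Y)) =
      N.map (contrGamma γ ((transpose N).map ξ) Y) + N.map (N.map (contrGamma γ ξ Y)) := by
  refine pairing_flip_bijective.1 (LinearMap.ext fun ζ => ?_)
  simp only [map_add, LinearMap.add_apply, LinearMap.flip_apply, ← pairing_transpose,
    pairing_contrGamma, bidualEquiv_map]
  exact γ.contrD_torsion (transpose_sq hsq) hγ _ ξ ζ

/-! ### Splitting the torsion on the double -/

theorem doubleSec_ext {u v : DoubleSec I F A} (h₁ : prodFst u = prodFst v)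
    (h₂ : prodSnd u = prodSnd v) : u = v := by
  refine ContMDiffSection.ext fun x => Prod.ext ?_ ?_
  · exact congrArg (fun s : Sec I F A => s x) h₁
  · exact congrArg (fun s : DualSec I F A => s x) h₂

variable (μ γ) in
-- Separates the pure μ-torsion from the mixed terms in γ. No condition on N² enters: only
-- additivity of N and the block-diagonal form are used.
theorem prodFst_torsion_doubleBracket (N : BundleHom I F A F A) (u v : DoubleSec I F A) :
    prodFst (torsion (doubleBracket μ γ) (doubleEndo N).map u v) =
      torsion (fun X Y => μ.bracket X Y) N.map (prodFst u) (prodFst v) +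
      (lieGamma γ (-(transpose N).map (prodSnd u)) (N.map (prodFst v)) -
        N.map (lieGamma γ (-(transpose N).map (prodSnd u)) (prodFst v) +
          lieGamma γ (prodSnd u) (N.map (prodFst v)) -
          N.map (lieGamma γ (prodSnd u) (prodFst v)))) -
      (contrGamma γ (-(transpose N).map (prodSnd v)) (N.map (prodFst u)) -
        N.map (contrGamma γ (-(transpose N).map (prodSnd v)) (prodFst u) +
          contrGamma γ (prodSnd v) (N.map (prodFst u)) -
          N.map (contrGamma γ (prodSnd v) (prodFst u)))) := by
  -- The A-component of the Dorfman bracket. As the endomorphism is block diagonal, the A-component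
  -- of the torsion involves the bracket only through `a`.
  let a (u v : DoubleSec I F A) : Sec I F A := μ.bracket (prodFst u) (prodFst v) +
    lieGamma γ (prodSnd u) (prodFst v) - contrGamma γ (prodSnd v) (prodFst u)
  have h : prodFst (torsion (doubleBracket μ γ) (doubleEndo N).map u v) =
      a ((doubleEndo N).map u) ((doubleEndo N).map v) -
        N.map (a ((doubleEndo N).map u) v + a u ((doubleEndo N).map v) - N.map (a u v)) := rfl
  have h₁ (u : DoubleSec I F A) : prodFst ((doubleEndo N).map u) = N.map (prodFst u) := rfl
  have h₂ (u : DoubleSec I F A) :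
      prodSnd ((doubleEndo N).map u) = -(transpose N).map (prodSnd u) := rfl
  rw [h]
  simp only [a, h₁, h₂, torsion, map_add, map_sub]
  abel

variable (μ γ) in
-- The pure term is the torsion of ᵗN although the block is -ᵗN, since torsion is quadratic in the
-- operator. In the mixed terms the sign survives.
theorem prodSnd_torsion_doubleBracket (N : BundleHom I F A F A) (u v : DoubleSec I F A) :
    prodSnd (torsion (doubleBracket μ γ) (doubleEndo N).map u v) =
      torsion (fun ξ η => γ.bracket ξ η) (transpose N).map (prodSnd u) (prodSnd v) +
      (lieMu μ (N.map (prodFst u)) (-(transpose N).map (prodSnd v)) +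
        (transpose N).map (lieMu μ (N.map (prodFst u)) (prodSnd v) +
          lieMu μ (prodFst u) (-(transpose N).map (prodSnd v)) +
          (transpose N).map (lieMu μ (prodFst u) (prodSnd v)))) -
      (contrMu μ (N.map (prodFst v)) (-(transpose N).map (prodSnd u)) +
        (transpose N).map (contrMu μ (N.map (prodFst v)) (prodSnd u) +
          contrMu μ (prodFst v) (-(transpose N).map (prodSnd u)) +
          (transpose N).map (contrMu μ (prodFst v) (prodSnd u)))) := by
  let a (u v : DoubleSec I F A) : DualSec I F A := γ.bracket (prodSnd u) (prodSnd v) +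
    lieMu μ (prodFst u) (prodSnd v) - contrMu μ (prodFst v) (prodSnd u)
  have h : prodSnd (torsion (doubleBracket μ γ) (doubleEndo N).map u v) =
      a ((doubleEndo N).map u) ((doubleEndo N).map v) -
        -(transpose N).map (a ((doubleEndo N).map u) v + a u ((doubleEndo N).map v) -
          -(transpose N).map (a u v)) := rfl
  have h₁ (u : DoubleSec I F A) : prodFst ((doubleEndo N).map u) = N.map (prodFst u) := rfl
  have h₂ (u : DoubleSec I F A) :
      prodSnd ((doubleEndo N).map u) = -(transpose N).map (prodSnd u) := rfl
  rw [h]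
  simp only [a, h₁, h₂, torsion, map_add, map_sub, map_neg, LinearMap.neg_apply]
  abel

/-- N on one argument and -ᵗN on the other contribute opposite pairings, which cancel in pairs. -/
theorem doubleForm_doubleEndo (N : BundleHom I F A F A) (u v : DoubleSec I F A) :
    doubleForm ((doubleEndo N).map u) v + doubleForm u ((doubleEndo N).map v) = 0 := by
  have h₁ (u : DoubleSec I F A) : prodFst ((doubleEndo N).map u) = N.map (prodFst u) := rfl
  have h₂ (u : DoubleSec I F A) :
      prodSnd ((doubleEndo N).map u) = -(transpose N).map (prodSnd u) := rfl
  simp only [doubleForm, h₁, h₂, map_neg, LinearMap.neg_apply, pairing_transpose]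
  abel

set_option synthInstance.maxHeartbeats 200000 in
theorem torsion_doubleBracket_doubleEndo (hsq : ∀ X, N.map (N.map X) = r • X)
    (hμ : ∀ X Y, torsion (fun X Y => μ.bracket X Y) N.map X Y = 0)
    (hγ : ∀ ξ η, torsion (fun ξ η => γ.bracket ξ η) (transpose N).map ξ η = 0)
    (u v : DoubleSec I F A) : torsion (doubleBracket μ γ) (doubleEndo N).map u v = 0 := by
  refine doubleSec_ext ?_ ?_
  · have h₁ := lieGamma_torsion hsq hγ (prodSnd u) (prodFst v)
    have h₂ := contrGamma_torsion hsq hγ (prodSnd v) (prodFst u)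
    rw [prodFst_torsion_doubleBracket, hμ]
    simp only [lieGamma_neg_left, contrGamma_neg_left, map_add, map_sub, map_neg]
    -- Each identity is solved for the term with N and ᵗN both inside the operation; after
    -- substitution the rest cancels additively.
    rw [eq_sub_of_add_eq h₁, eq_sub_of_add_eq h₂]
    -- The component of the zero section is zero by definition; `abel` needs to see it as such.
    change _ = (0 : Sec I F A)
    abel
  · have h₁ := lieMu_torsion hsq hμ (prodFst u) (prodSnd v)
    have h₂ := contrMu_torsion hsq hμ (prodFst v) (prodSnd u)
    rw [prodSnd_torsion_doubleBracket, hγ]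
    simp only [lieMu_neg_right, contrMu_neg_right, map_add, map_neg]
    rw [eq_sub_of_add_eq h₁, eq_sub_of_add_eq h₂]
    change _ = (0 : DualSec I F A)
    abel

end Double

end LieBialg

theorem theorem4p3
    -- a smooth manifold `M`
    {E : Type*} [NormedAddCommGroup E] [NormedSpace ℝ E] [FiniteDimensional ℝ E]
    {H : Type*} [TopologicalSpace H] {I : ModelWithCorners ℝ E H}
    {M : Type*} [TopologicalSpace M] [ChartedSpace H M] [IsManifold I ∞ M] [T2Space M]
    -- a smooth real vector bundle `A` over `M` of finite rank
    {F : Type*} [NormedAddCommGroup F] [NormedSpace ℝ F] [FiniteDimensional ℝ F]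
    {A : M → Type*} [TopologicalSpace (TotalSpace F A)] [∀ x, TopologicalSpace (A x)]
    [∀ x, AddCommGroup (A x)] [∀ x, Module ℝ (A x)]
    [∀ x, IsTopologicalAddGroup (A x)] [∀ x, ContinuousSMul ℝ (A x)]
    [FiberBundle F A] [VectorBundle ℝ F A] [ContMDiffVectorBundle ∞ F A I]
    -- a Lie bialgebroid `((A, μ), (A*, γ))`
    (μ : LieBialg.LieAlgebroid I F A)
    (γ : LieBialg.LieAlgebroid I (F →L[ℝ] ℝ) (LieBialg.DualBundle A))
    (hμγ : LieBialg.IsLieBialgebroid μ γ)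
    -- an endomorphism `N` of `A`
    (N : LieBialg.BundleHom I F A F A)
    (hN : LieBialg.IsProportionalToAlmostCps N)
    (hμ : ∀ X Y : LieBialg.Sec I F A,
      LieBialg.torsion (fun X Y => μ.bracket X Y) (LieBialg.BundleHom.map N) X Y = 0)
    (hγ : ∀ ξ η : LieBialg.DualSec I F A,
      LieBialg.torsion (fun ξ η => γ.bracket ξ η)
        (LieBialg.BundleHom.map (LieBialg.transpose N)) ξ η = 0) :
    LieBialg.IsNijenhuisTensor LieBialg.doubleForm (LieBialg.doubleBracket μ γ)
      (LieBialg.doubleEndo N) := by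
  obtain ⟨r, hsq⟩ := hN.exists_sq
  exact ⟨LieBialg.doubleForm_doubleEndo N,
    LieBialg.torsion_doubleBracket_doubleEndo hsq hμ hγ⟩
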